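/- A $3$-graph $H=(V,E)$ consists of a finite vertex set $V$ and a set $E$ of $3$-element subsets of $V$. For a $3$-graph $F$, let $\mathrm{ex}(n,F)$ be the maximum number of edges of a $3$-graph on $n$ vertices that contains no (not necessarily induced) copy of $F$, and let $\pi(F)=\lim_{n\to\infty}\mathrm{ex}(n,F)/\binom{n}{3}$ be its Turán density. Let $K_5^{(3)-}$ be the $3$-graph on $5$ vertices whose edges are all the $3$-element sets of vertices except one. Theorem. The limit defining $\pi(K_5^{(3)-})$ exists, and $$\pi(K_5^{(3)-})\;\geq\;\frac{31097+277\sqrt{277}}{59248}=0.602673\ldots$$ -/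

import Mathlib

/-- A `k`-uniform hypergraph (`k`-graph) with vertex set the type `V`: a finite set of edges, each
of which is a set of exactly `k` vertices. -/
structure UniformHypergraph (k : ℕ) (V : Type*) where
  edges : Finset (Finset V)
  card_of_mem : ∀ e ∈ edges, e.card = k

namespace UniformHypergraph

/-- `H` contains a copy of `F` (not necessarily induced): some injection of the vertices of `F`
into those of `H` maps every edge of `F` to an edge of `H`. -/
def Contains {k : ℕ} {V W : Type*} (H : UniformHypergraph k V) (F : UniformHypergraph k W) :
    Prop :=
  ∃ f : W ↪ V, ∀ e ∈ F.edges, e.map f ∈ H.edges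

/-- `H` is `F`-free. -/
def IsFree {k : ℕ} {V W : Type*} (H : UniformHypergraph k V) (F : UniformHypergraph k W) :
    Prop :=
  ¬ H.Contains F

/-- The set of all edge numbers of `F`-free `k`-graphs on `n` vertices. -/
def freeEdgeNumbers {k : ℕ} {W : Type*} (n : ℕ) (F : UniformHypergraph k W) : Set ℕ :=
  {m | ∃ H : UniformHypergraph k (Fin n), H.IsFree F ∧ H.edges.card = m}

/-- The Turán number `ex(n, F)`: the maximum number of edges of an `F`-free `k`-graph on `n`
vertices (and `0` if there is no `F`-free `k`-graph on `n` vertices). -/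
noncomputable def turanNumber {k : ℕ} {W : Type*} (n : ℕ) (F : UniformHypergraph k W) : ℕ :=
  sSup (freeEdgeNumbers n F)

theorem bddAbove_freeEdgeNumbers {k : ℕ} {W : Type*} (n : ℕ) (F : UniformHypergraph k W) :
    BddAbove (freeEdgeNumbers n F) := by
  refine ⟨n.choose k, ?_⟩
  rintro m ⟨H, -, rfl⟩
  have hsub : H.edges ⊆ Finset.powersetCard k (Finset.univ : Finset (Fin n)) := fun e he =>
    Finset.mem_powersetCard.2 ⟨Finset.subset_univ e, H.card_of_mem e he⟩
  simpa using Finset.card_le_card hsub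

/-- The supremum defining `ex(n, F)` is a maximum as soon as some `F`-free `k`-graph on `n`
vertices exists. -/
theorem isGreatest_turanNumber {k : ℕ} {W : Type*} (n : ℕ) (F : UniformHypergraph k W)
    (h : (freeEdgeNumbers n F).Nonempty) :
    IsGreatest (freeEdgeNumbers n F) (turanNumber n F) :=
  ⟨Nat.sSup_mem h (bddAbove_freeEdgeNumbers n F),
    fun _ hm => le_csSup (bddAbove_freeEdgeNumbers n F) hm⟩

/-- The ratio `ex(n, F) / binom(n, k)`. -/
noncomputable def turanRatio {k : ℕ} {W : Type*} (F : UniformHypergraph k W) (n : ℕ) : ℝ :=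
  (turanNumber n F : ℝ) / (n.choose k : ℝ)

/-- The Turán density `π(F) = lim_{n → ∞} ex(n, F) / binom(n, k)`. -/
noncomputable def turanDensity {k : ℕ} {W : Type*} (F : UniformHypergraph k W) : ℝ :=
  Filter.limUnder Filter.atTop (turanRatio F)

/-- `K_ℓ^{(k)-}`: all `k`-subsets of an `ℓ`-element vertex set except one, namely the set of the
first `k` vertices (for `k ≤ ℓ`; all choices of the missing edge give isomorphic `k`-graphs). -/
def completeMinusEdge (k l : ℕ) : UniformHypergraph k (Fin l) where
  edges := (Finset.powersetCard k Finset.univ).erase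
    (Finset.univ.filter fun i : Fin l => (i : ℕ) < k)
  card_of_mem _ he := (Finset.mem_powersetCard.1 (Finset.mem_of_mem_erase he)).2

end UniformHypergraph

/-!
The limit exists by the averaging argument of Katona, Nemetz and Simonovits: deleting a vertex of
an extremal `k`-graph on `n + 1` vertices in all possible ways shows that
`ex(n, F) / binom(n, k)` is nonincreasing from `n = k` on
(`UniformHypergraph.turanRatio_succ_le`).

The lower bound comes from an explicit construction, which gives the larger value
`30 / 49 = 0.612…`. Colour the vertices with `ℤ/7`, all colour classes having the same size, and
take as edges the triples whose colours are

* three distinct elements that do not form a line `{t, t + 1, t + 3}` of the Fano plane, or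
* of the form `i, i, i + 1` or `i, i, i + 3`.

Any five colours, repetitions allowed, leave at least two of the ten triples uncovered
(for five distinct colours these are the two lines of the Fano plane that avoid the other two
points), so there is no copy of `K_5^{(3)-}`; the finite check is
`FanoPattern.not_all_but_one`. Of the `343` ordered triples of colours `28 * 6 + 14 * 3 = 210`
are admissible, so the density tends to `210 / 343 = 30 / 49`.
-/

open Filter Topology

namespace UniformHypergraph

/-! ### Existence of the Turán density -/

/-- The `k`-graph obtained by deleting the vertex `v`, its vertices relabelled
increasingly. -/
def deleteVertex {k n : ℕ} (H : UniformHypergraph k (Fin (n + 1))) (v : Fin (n + 1)) :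
    UniformHypergraph k (Fin n) where
  edges := Finset.univ.filter fun e => e.map v.succAboveEmb ∈ H.edges
  card_of_mem e he := by
    simpa using H.card_of_mem _ (Finset.mem_filter.1 he).2

theorem IsFree.deleteVertex {k n : ℕ} {W : Type*} {F : UniformHypergraph k W}
    {H : UniformHypergraph k (Fin (n + 1))} (hH : H.IsFree F) (v : Fin (n + 1)) :
    (H.deleteVertex v).IsFree F := by
  rintro ⟨f, hf⟩
  refine hH ⟨f.trans v.succAboveEmb, fun e he => ?_⟩
  rw [← Finset.map_map]
  exact (Finset.mem_filter.1 (hf e he)).2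

theorem card_edges_deleteVertex {k n : ℕ} (H : UniformHypergraph k (Fin (n + 1)))
    (v : Fin (n + 1)) :
    (H.deleteVertex v).edges.card = (H.edges.filter fun e => v ∉ e).card := by
  classical
  rw [← Finset.card_map (Finset.mapEmbedding v.succAboveEmb).toEmbedding]
  congr 1
  ext e
  simp only [deleteVertex, Finset.mem_map, Finset.mem_filter, Finset.mem_univ, true_and,
    RelEmbedding.coe_toEmbedding, Finset.mapEmbedding_apply]
  constructor
  · rintro ⟨e', he', rfl⟩
    exact ⟨he', by simp [Fin.succAbove_ne]⟩
  · rintro ⟨he, hv⟩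
    have hmap : (Finset.univ.filter fun w => v.succAbove w ∈ e).map v.succAboveEmb = e := by
      ext w
      simp only [Finset.mem_map, Finset.mem_filter, Finset.mem_univ, true_and,
        Fin.succAboveEmb_apply]
      constructor
      · rintro ⟨u, hu, rfl⟩
        exact hu
      · intro hw
        obtain ⟨u, hu⟩ := Fin.exists_succAbove_eq fun h : w = v => hv (h ▸ hw)
        exact ⟨u, hu.symm ▸ hw, hu⟩
    exact ⟨_, by rwa [hmap], hmap⟩

theorem sum_card_edges_deleteVertex {k n : ℕ} (H : UniformHypergraph k (Fin (n + 1))) :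
    ∑ v, (H.deleteVertex v).edges.card = H.edges.card * (n + 1 - k) := by
  classical
  simp only [card_edges_deleteVertex, Finset.card_filter]
  rw [Finset.sum_comm]
  refine Finset.sum_const_nat fun e he => ?_
  rw [← Finset.card_filter, Finset.filter_not, Finset.filter_mem_eq_inter, Finset.univ_inter,
    Finset.card_sdiff_of_subset (Finset.subset_univ e), H.card_of_mem e he]
  simp

theorem freeEdgeNumbers_nonempty {k : ℕ} {W : Type*} {F : UniformHypergraph k W}
    (hF : F.edges.Nonempty) (n : ℕ) : (freeEdgeNumbers n F).Nonempty := by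
  obtain ⟨e, he⟩ := hF
  exact ⟨0, ⟨∅, by simp⟩, fun ⟨f, hf⟩ => by simpa using hf e he, rfl⟩

theorem card_edges_le_turanNumber {k n : ℕ} {W : Type*} {F : UniformHypergraph k W}
    {H : UniformHypergraph k (Fin n)} (hH : H.IsFree F) :
    H.edges.card ≤ turanNumber n F :=
  le_csSup (bddAbove_freeEdgeNumbers n F) ⟨H, hH, rfl⟩

theorem turanNumber_succ_mul_le {k : ℕ} {W : Type*} {F : UniformHypergraph k W}
    (hF : F.edges.Nonempty) (n : ℕ) :
    turanNumber (n + 1) F * (n + 1 - k) ≤ turanNumber n F * (n + 1) := by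
  obtain ⟨H, hH, hcard⟩ := (isGreatest_turanNumber (n + 1) F (freeEdgeNumbers_nonempty hF _)).1
  rw [← hcard, ← sum_card_edges_deleteVertex]
  calc ∑ v, (H.deleteVertex v).edges.card
      ≤ ∑ _v : Fin (n + 1), turanNumber n F :=
        Finset.sum_le_sum fun v _ => card_edges_le_turanNumber (hH.deleteVertex v)
    _ = turanNumber n F * (n + 1) := by simp [mul_comm]

theorem turanRatio_succ_le {k : ℕ} {W : Type*} {F : UniformHypergraph k W}
    (hF : F.edges.Nonempty) {n : ℕ} (hn : k ≤ n) :
    turanRatio F (n + 1) ≤ turanRatio F n := by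
  have h₁ : (turanNumber (n + 1) F : ℝ) * ((n + 1 - k : ℕ) : ℝ) ≤ turanNumber n F * (n + 1) := by
    exact_mod_cast turanNumber_succ_mul_le hF n
  have h₂ : (n.choose k : ℝ) * (n + 1) = (n + 1).choose k * ((n + 1 - k : ℕ) : ℝ) := by
    exact_mod_cast Nat.choose_mul_succ_eq n k
  have hpos : (0 : ℝ) < n.choose k := by exact_mod_cast Nat.choose_pos hn
  have hpos' : (0 : ℝ) < (n + 1).choose k := by exact_mod_cast Nat.choose_pos (by omega)
  have hd : (0 : ℝ) < ((n + 1 - k : ℕ) : ℝ) := by exact_mod_cast (by omega : 0 < n + 1 - k)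
  rw [turanRatio, turanRatio, div_le_div_iff₀ hpos' hpos]
  refine le_of_mul_le_mul_right ?_ hd
  calc (turanNumber (n + 1) F : ℝ) * n.choose k * ((n + 1 - k : ℕ) : ℝ)
      = (turanNumber (n + 1) F * ((n + 1 - k : ℕ) : ℝ)) * n.choose k := by ring
    _ ≤ (turanNumber n F * (n + 1)) * n.choose k := by gcongr
    _ = turanNumber n F * (n.choose k * (n + 1)) := by ring
    _ = turanNumber n F * (n + 1).choose k * ((n + 1 - k : ℕ) : ℝ) := by rw [h₂]; ring

theorem tendsto_turanRatio {k : ℕ} {W : Type*} {F : UniformHypergraph k W}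
    (hF : F.edges.Nonempty) :
    Tendsto (turanRatio F) atTop (𝓝 (turanDensity F)) := by
  have hanti : Antitone fun n => turanRatio F (n + k) :=
    antitone_nat_of_succ_le fun n => by
      rw [Nat.add_right_comm]
      exact turanRatio_succ_le hF (by omega)
  have hbdd : BddBelow (Set.range fun n => turanRatio F (n + k)) :=
    ⟨0, by rintro _ ⟨n, rfl⟩; exact div_nonneg (Nat.cast_nonneg _) (Nat.cast_nonneg _)⟩
  exact tendsto_nhds_limUnder
    ⟨_, (tendsto_add_atTop_iff_nat k).1 (tendsto_atTop_ciInf hanti hbdd)⟩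

end UniformHypergraph

/-! ### A pattern of triples on seven points -/

namespace FanoPattern

/-- The admissible triples of colours: three distinct colours that are not a line
`{t, t + 1, t + 3}` of the Fano plane on `ℤ/7`, or `i, i, i + 1`, or `i, i, i + 3`, each in any
order. Boolean valued, so that statements about it can be decided by evaluation. -/
def admissible (a b c : Fin 7) : Bool :=
  if a = b then c = a + 1 || c = a + 3
  else if a = c then b = a + 1 || b = a + 3
  else if b = c then a = b + 1 || a = b + 3
  else !(isLine a b c || isLine a c b || isLine b a c || isLine b c a || isLine c a b ||
    isLine c b a)
where
  /-- The ordered triples `(t, t + 1, t + 3)`. -/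
  isLine (a b c : Fin 7) : Bool := b = a + 1 && c = a + 3

theorem admissible_swap_left (a b c : Fin 7) : admissible a b c = admissible b a c := by
  revert a b c; decide +kernel

theorem admissible_swap_right (a b c : Fin 7) : admissible a b c = admissible a c b := by
  revert a b c; decide +kernel

/-- No five colours have all their triples admissible except possibly `{a, b, c}`. -/
theorem not_all_but_one (d e a b c : Fin 7)
    (had : admissible a d e = true) (hbd : admissible b d e = true)
    (hcd : admissible c d e = true)
    (habd : admissible a b d = true) (habe : admissible a b e = true)
    (hacd : admissible a c d = true) (hace : admissible a c e = true)
    (hbcd : admissible b c d = true) (hbce : admissible b c e = true) : False := by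
  revert d e a b c; decide +kernel

theorem card_admissible :
    (Finset.univ.filter fun p : Fin 7 × Fin 7 × Fin 7 =>
      admissible p.1 p.2.1 p.2.2 = true).card = 210 := by
  decide +kernel

/-! ### Blow-ups of the pattern -/

/-- The `3`-graph of all triples of vertices whose colours under `κ` are admissible. -/
def blowUp {V : Type*} [Fintype V] [DecidableEq V] (κ : V → Fin 7) : UniformHypergraph 3 V where
  edges := Finset.univ.filter fun e => e.card = 3 ∧
    ∃ a b c, e = {a, b, c} ∧ admissible (κ a) (κ b) (κ c) = true
  card_of_mem _ he := (Finset.mem_filter.1 he).2.1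

variable {V : Type*} [Fintype V] [DecidableEq V] {κ : V → Fin 7}

theorem admissible_of_mem {a b c : V} (h : {a, b, c} ∈ (blowUp κ).edges) :
    admissible (κ a) (κ b) (κ c) = true := by
  simp only [blowUp, Finset.mem_filter, Finset.mem_univ, true_and] at h
  obtain ⟨hcard, x, y, z, he, hadm⟩ := h
  have hL := admissible_swap_left
  have hR := admissible_swap_right
  have hne : a ≠ b ∧ a ≠ c ∧ b ≠ c := by
    have hle : ∀ x y : V, ¬ ({a, b, c} : Finset V) ⊆ {x, y} := fun x y h => by
      have := (Finset.card_le_card h).trans Finset.card_le_two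
      omega
    refine ⟨?_, ?_, ?_⟩ <;> rintro rfl
    · exact hle a c (by simp)
    · exact hle a b (by simp [Finset.subset_iff])
    · exact hle a b (by simp)
  have ha := (Finset.ext_iff.1 he a).1 (by simp)
  have hb := (Finset.ext_iff.1 he b).1 (by simp)
  have hc := (Finset.ext_iff.1 he c).1 (by simp)
  simp only [Finset.mem_insert, Finset.mem_singleton] at ha hb hc
  rcases ha with rfl | rfl | rfl <;> rcases hb with rfl | rfl | rfl <;>
    rcases hc with rfl | rfl | rfl <;> grind

theorem isFree_blowUp (κ : V → Fin 7) :
    (blowUp κ).IsFree (UniformHypergraph.completeMinusEdge 3 5) := by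
  rintro ⟨f, hf⟩
  have key : ∀ i j k : Fin 5,
      ({i, j, k} : Finset (Fin 5)) ∈ (UniformHypergraph.completeMinusEdge 3 5).edges →
      admissible (κ (f i)) (κ (f j)) (κ (f k)) = true := by
    intro i j k h
    have := hf _ h
    rw [Finset.map_insert, Finset.map_insert, Finset.map_singleton] at this
    exact admissible_of_mem this
  exact not_all_but_one (κ (f 3)) (κ (f 4)) (κ (f 0)) (κ (f 1)) (κ (f 2))
    (key _ _ _ (by decide)) (key _ _ _ (by decide)) (key _ _ _ (by decide))
    (key _ _ _ (by decide)) (key _ _ _ (by decide)) (key _ _ _ (by decide))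
    (key _ _ _ (by decide)) (key _ _ _ (by decide)) (key _ _ _ (by decide))

/-- Each edge comes from at most six ordered triples of vertices, and at most `3 * |V| ^ 2`
ordered triples have a repeated vertex. -/
theorem card_admissible_le (κ : V → Fin 7) :
    (Finset.univ.filter fun p : V × V × V =>
      admissible (κ p.1) (κ p.2.1) (κ p.2.2) = true).card ≤
    6 * (blowUp κ).edges.card + 3 * Fintype.card V ^ 2 := by
  set A := Finset.univ.filter fun p : V × V × V =>
    admissible (κ p.1) (κ p.2.1) (κ p.2.2) = true
  let D := A.filter fun p => p.1 ≠ p.2.1 ∧ p.1 ≠ p.2.2 ∧ p.2.1 ≠ p.2.2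
  have hD : D.card ≤ 6 * (blowUp κ).edges.card := by
    refine Finset.card_le_mul_card_image_of_maps_to
      (f := fun p : V × V × V => ({p.1, p.2.1, p.2.2} : Finset V)) ?_ 6 ?_
    · rintro ⟨a, b, c⟩ hp
      simp only [D, A, Finset.mem_filter, Finset.mem_univ, true_and] at hp
      obtain ⟨hadm, hab, hac, hbc⟩ := hp
      simp only [blowUp, Finset.mem_filter, Finset.mem_univ, true_and]
      exact ⟨Finset.card_eq_three.2 ⟨a, b, c, hab, hac, hbc, rfl⟩, a, b, c, rfl, hadm⟩
    · intro e he
      obtain ⟨x, y, z, -, -, -, rfl⟩ := Finset.card_eq_three.1 ((blowUp κ).card_of_mem e he)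
      refine (Finset.card_le_card (t := {(x, y, z), (x, z, y), (y, x, z), (y, z, x), (z, x, y),
        (z, y, x)}) ?_).trans Finset.card_le_six
      rintro ⟨a, b, c⟩ hp
      simp only [D, Finset.mem_filter] at hp
      obtain ⟨⟨-, hab, hac, hbc⟩, heq⟩ := hp
      have ha : a ∈ ({x, y, z} : Finset V) := heq ▸ by simp
      have hb : b ∈ ({x, y, z} : Finset V) := heq ▸ by simp
      have hc : c ∈ ({x, y, z} : Finset V) := heq ▸ by simp
      simp only [Finset.mem_insert, Finset.mem_singleton, Prod.mk.injEq] at ha hb hc ⊢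
      grind
  let R : Finset (V × V × V) :=
    (Finset.univ.image fun q : V × V => (q.1, q.1, q.2)) ∪
    (Finset.univ.image fun q : V × V => (q.1, q.2, q.1)) ∪
    (Finset.univ.image fun q : V × V => (q.2, q.1, q.1))
  have hR : R.card ≤ 3 * Fintype.card V ^ 2 := by
    have h : ∀ g : V × V → V × V × V, (Finset.univ.image g).card ≤ Fintype.card V ^ 2 :=
      fun g => Finset.card_image_le.trans (by simp [sq])
    calc R.card ≤ Fintype.card V ^ 2 + Fintype.card V ^ 2 + Fintype.card V ^ 2 :=
          (Finset.card_union_le _ _).trans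
            (add_le_add ((Finset.card_union_le _ _).trans (add_le_add (h _) (h _))) (h _))
      _ = 3 * Fintype.card V ^ 2 := by ring
  have hsub : A ⊆ D ∪ R := by
    rintro ⟨a, b, c⟩ hp
    by_cases hab : a = b
    · simp [R, hab]
    by_cases hac : a = c
    · simp [R, hac]
    by_cases hbc : b = c
    · simp [R, hbc]
    · simp [D, hp, hab, hac, hbc]
  exact (Finset.card_le_card hsub).trans ((Finset.card_union_le _ _).trans (add_le_add hD hR))

/-- The colouring of `7 * m` vertices with seven colour classes of size `m`. -/
def balanced (m : ℕ) (v : Fin (m * 7)) : Fin 7 := (finProdFinEquiv.symm v).2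

theorem card_admissible_balanced (m : ℕ) :
    (Finset.univ.filter fun p : Fin (m * 7) × Fin (m * 7) × Fin (m * 7) =>
      admissible (balanced m p.1) (balanced m p.2.1) (balanced m p.2.2) = true).card =
    210 * m ^ 3 := by
  have hcard : (Finset.univ ×ˢ Finset.univ.filter fun p : Fin 7 × Fin 7 × Fin 7 =>
      admissible p.1 p.2.1 p.2.2 = true : Finset ((Fin m × Fin m × Fin m) × _)).card =
      210 * m ^ 3 := by
    rw [Finset.card_product, card_admissible]
    simp
    ring
  rw [← hcard]
  let σ : Fin (m * 7) ≃ Fin m × Fin 7 := finProdFinEquiv.symm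
  refine Finset.card_nbij'
    (fun p => (((σ p.1).1, (σ p.2.1).1, (σ p.2.2).1), ((σ p.1).2, (σ p.2.1).2, (σ p.2.2).2)))
    (fun q => (σ.symm (q.1.1, q.2.1), σ.symm (q.1.2.1, q.2.2.1), σ.symm (q.1.2.2, q.2.2.2)))
    ?_ ?_ ?_ ?_
  · intro p hp
    exact Finset.mem_product.2
      ⟨Finset.mem_univ _, Finset.mem_filter.2 ⟨Finset.mem_univ _, (Finset.mem_filter.1 hp).2⟩⟩
  · intro q hq
    refine Finset.mem_filter.2 ⟨Finset.mem_univ _, ?_⟩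
    simpa [balanced, σ, -finProdFinEquiv_symm_apply] using
      (Finset.mem_filter.1 (Finset.mem_product.1 hq).2).2
  · intro p _
    simp
  · intro q _
    simp

theorem le_turanNumber (m : ℕ) :
    210 * m ^ 3 ≤
      6 * UniformHypergraph.turanNumber (m * 7) (UniformHypergraph.completeMinusEdge 3 5) +
        147 * m ^ 2 := by
  have h₁ := card_admissible_le (balanced m)
  have h₂ := UniformHypergraph.card_edges_le_turanNumber (isFree_blowUp (balanced m))
  rw [card_admissible_balanced, Fintype.card_fin, mul_pow] at h₁
  omega

theorem le_turanRatio {m : ℕ} (hm : 0 < m) :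
    30 / 49 - 3 / 7 * (1 / (m : ℝ)) ≤
      UniformHypergraph.turanRatio (UniformHypergraph.completeMinusEdge 3 5) (m * 7) := by
  set T := UniformHypergraph.turanNumber (m * 7) (UniformHypergraph.completeMinusEdge 3 5)
  have hm' : (0 : ℝ) < m := by exact_mod_cast hm
  have h : 210 * (m : ℝ) ^ 3 ≤ 6 * T + 147 * (m : ℝ) ^ 2 := by exact_mod_cast le_turanNumber m
  have hchoose : ((m * 7).choose 3 : ℝ) ≤ 343 * (m : ℝ) ^ 3 / 6 := by
    have := Nat.choose_le_pow_div (α := ℝ) 3 (m * 7)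
    norm_num [Nat.factorial] at this
    linarith
  have hpos : (0 : ℝ) < (m * 7).choose 3 := by exact_mod_cast Nat.choose_pos (by omega)
  calc 30 / 49 - 3 / 7 * (1 / (m : ℝ))
      = (210 * (m : ℝ) ^ 3 - 147 * (m : ℝ) ^ 2) / 6 / (343 * (m : ℝ) ^ 3 / 6) := by
        field_simp
        ring
    _ ≤ T / (343 * (m : ℝ) ^ 3 / 6) := by
        gcongr
        linarith
    _ ≤ T / ((m * 7).choose 3 : ℝ) := by gcongr

end FanoPattern

/-! ### The lower bound -/

theorem UniformHypergraph.completeMinusEdge_three_five_nonempty :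
    (UniformHypergraph.completeMinusEdge 3 5).edges.Nonempty :=
  ⟨{0, 1, 3}, by decide⟩

theorem UniformHypergraph.le_turanDensity_completeMinusEdge_three_five :
    30 / 49 ≤ UniformHypergraph.turanDensity (UniformHypergraph.completeMinusEdge 3 5) := by
  have hlim := UniformHypergraph.tendsto_turanRatio
    UniformHypergraph.completeMinusEdge_three_five_nonempty
  have hmul : Tendsto (fun m : ℕ => m * 7) atTop atTop := tendsto_id.atTop_mul_const' (by norm_num)
  have hlow : Tendsto (fun m : ℕ => 30 / 49 - 3 / 7 * (1 / (m : ℝ))) atTop (𝓝 (30 / 49)) := by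
    simpa using (tendsto_one_div_atTop_nhds_zero_nat (𝕜 := ℝ)).const_mul (3 / 7) |>.const_sub
      (30 / 49)
  refine le_of_tendsto_of_tendsto hlow (hlim.comp hmul) ?_
  filter_upwards [eventually_gt_atTop 0] with m hm
  exact FanoPattern.le_turanRatio hm

/-- The limit defining the Turán density of `K_5^{(3)-}` exists, and it is at least
`(31097 + 277 √277) / 59248 = 0.602673…`. -/
theorem theorem1p4 :
    Filter.Tendsto (UniformHypergraph.turanRatio (UniformHypergraph.completeMinusEdge 3 5))
        Filter.atTop
        (nhds (UniformHypergraph.turanDensity (UniformHypergraph.completeMinusEdge 3 5))) ∧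
      (31097 + 277 * Real.sqrt 277) / 59248 ≤
        UniformHypergraph.turanDensity (UniformHypergraph.completeMinusEdge 3 5) ∧
      (0.602673 : ℝ) ≤ (31097 + 277 * Real.sqrt 277) / 59248 ∧
      (31097 + 277 * Real.sqrt 277) / 59248 < (0.602674 : ℝ) := by
  have hlow : (16.6433 : ℝ) ≤ Real.sqrt 277 := Real.le_sqrt_of_sq_le (by norm_num)
  have hupp : Real.sqrt 277 < (16.6434 : ℝ) := by
    rw [Real.sqrt_lt' (by norm_num)]
    norm_num
  refine ⟨UniformHypergraph.tendsto_turanRatio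
    UniformHypergraph.completeMinusEdge_three_five_nonempty, ?_, ?_, ?_⟩
  · refine le_trans ?_ UniformHypergraph.le_turanDensity_completeMinusEdge_three_five
    linarith
  · linarith
  · linarith
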